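/- For real $\alpha$ with $|\alpha|<1$, let $am(\cdot,\alpha):\mathbb R\to\mathbb R$ be the inverse function of $\phi\mapsto\int_0^{\phi}\frac{dt}{\sqrt{1-\alpha^2\sin^2 t}}$, and let $cn(u,\alpha)=\cos am(u,\alpha)$ be the Jacobi elliptic function. (1) There is exactly one sequence of polynomials $c_n(q)\in\mathbb R[q]$, $n\ge 0$, such that for every $\alpha$ with $|\alpha|<1$ $$cn(u,\alpha)=\sum_{n\ge 0}(-1)^n c_n(\alpha^2)\frac{u^{2n}}{(2n)!}$$ for all $u$ in a neighbourhood of $0$. (2) For all $n,k\ge 0$, the coefficient of $q^k$ in $c_n(q)$ is the number of alternating permutations $\pi(1)>\pi(2)<\pi(3)>\cdots$ of $[2n]=\{1,\dots,2n\}$ having exactly $k$ minima of even value. Here a minimum is a letter $\pi(i)$ that is smaller than each of its neighbours in the word $\pi(1)\cdots\pi(2n)$; an end letter has only one neighbour. (3) The sequence $\{c_n(q)\}_{n\ge 0}$ is $3$-$q$-log-convex: for every $0\le m\le 3$, all polynomials of the sequence $\mathcal L^m\{c_n(q)\}$ have only nonnegative coefficients, where $\mathcal L$ maps a sequence of polynomials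 $\{f_i(q)\}_{i\ge s}$ to the sequence $\{f_{i-1}(q)f_{i+1}(q)-f_i(q)^2\}_{i\ge s+1}$. -/

import Mathlib

open scoped Polynomial

/-- The sequence operator `f ↦ (f_{i-1} f_{i+1} - f_i ^ 2)_{i ≥ 1}` on polynomial sequences,
reindexed so that the new sequence again starts at index `0`. -/
noncomputable def logConvexOp (f : ℕ → ℝ[X]) : ℕ → ℝ[X] :=
  fun i => f i * f (i + 2) - f (i + 1) ^ 2

/-- `k`-`q`-log-convexity: for all `m ≤ k`, every polynomial of the `m`-th iterate of
`logConvexOp` (including the sequence itself, `m = 0`) has only nonnegative coefficients. -/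
def IsQLogConvex (k : ℕ) (f : ℕ → ℝ[X]) : Prop :=
  ∀ m ≤ k, ∀ i j : ℕ, 0 ≤ ((logConvexOp^[m] f) i).coeff j

/-- The incomplete elliptic integral of the first kind with modulus `α`. -/
noncomputable def ellipticF (α φ : ℝ) : ℝ :=
  ∫ t in (0 : ℝ)..φ, 1 / √(1 - α ^ 2 * Real.sin t ^ 2)

/-- The Jacobi amplitude `am(u, α)`, the inverse function of `φ ↦ ellipticF α φ`
(which is a bijection of `ℝ` when `|α| < 1`). -/
noncomputable def jacobiAm (α u : ℝ) : ℝ :=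
  Function.invFun (ellipticF α) u

/-- The Jacobi elliptic function `cn(u, α) = cos am(u, α)`. -/
noncomputable def jacobiCn (α u : ℝ) : ℝ :=
  Real.cos (jacobiAm α u)

/-- `c_n(q)`, `n ≥ 0`, are the Taylor coefficient polynomials of `cn`: for every modulus
`-1 < α < 1`, `cn(u, α) = ∑ (-1) ^ n c_n(α ^ 2) u ^ (2 n) / (2 n)!` for `u` near `0`. -/
def IsCnTaylorSequence (c : ℕ → ℝ[X]) : Prop :=
  ∀ α : ℝ, |α| < 1 → ∀ᶠ u in nhds (0 : ℝ),
    HasSum (fun n : ℕ => (-1 : ℝ) ^ n * (c n).eval (α ^ 2) * u ^ (2 * n) /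
      (Nat.factorial (2 * n) : ℝ)) (jacobiCn α u)

/-- A permutation of `{0, …, N - 1}`, read as the word `σ 0, σ 1, …`, is alternating when
`σ 0 > σ 1 < σ 2 > σ 3 < ⋯`. -/
def IsAlternatingPerm {N : ℕ} (σ : Equiv.Perm (Fin N)) : Prop :=
  ∀ i j : Fin N, (j : ℕ) = i + 1 →
    (Even (i : ℕ) → σ j < σ i) ∧ (Odd (i : ℕ) → σ i < σ j)

/-- The letter of `σ` at position `i` is a minimum: it is smaller than each of its
neighbours in the word (an end letter has only one neighbour). -/
def IsPermMinimum {N : ℕ} (σ : Equiv.Perm (Fin N)) (i : Fin N) : Prop :=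
  ∀ j : Fin N, ((j : ℕ) = i + 1 ∨ (i : ℕ) = j + 1) → σ i < σ j

/-- The number of minima of even value; the letter `σ i` in `{0, …, N - 1}` stands for the
value `σ i + 1` in `{1, …, N}`. -/
noncomputable def evenMinimaCount {N : ℕ} (σ : Equiv.Perm (Fin N)) : ℕ :=
  Set.ncard {i : Fin N | IsPermMinimum σ i ∧ Even ((σ i : ℕ) + 1)}

/-!
Put `b_h = snʰ cn` for even `h` and `b_h = snʰ dn` for odd `h`. Then
`b_h' = h b_{h-1} - (h + 1) (α²)^[h odd] b_{h+1}`, so the Taylor coefficients of `cn = b_0` are sums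
over weighted Dyck paths, with weights `(h + 1) q^[h odd]` for a step up from height `h` and `h + 1`
for a step down to height `h`. The same weighted paths count alternating permutations: insert the
letters `0, 1, 2, …` in increasing order into a word of peaks and valleys. A new letter is either a
valley, which creates an undetermined peak, or the value of an undetermined peak, and the height is
the number of undetermined peaks.

The Hankel matrix of a sequence of such path sums is the product of two totally positive matrices,
so by the Cauchy–Binet formula its minors have nonnegative coefficients. The iterates `ℒ`, `ℒ²`
and `ℒ³` are polynomials with nonnegative coefficients in contiguous Hankel minors of size at most
four.
-/

/-! ### Total positivity -/

section TotalPositivity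

variable {R ι κ : Type*} [CommRing R]

theorem det_mul_eq_sum_minors [Fintype κ] [LinearOrder κ] {m : ℕ}
    (A : Matrix (Fin m) κ R) (B : Matrix κ (Fin m) R) :
    (A * B).det = ∑ s : Set.powersetCard κ m,
      (A.submatrix id (Set.powersetCard.ofFinEmbEquiv.symm s)).det *
        (B.submatrix (Set.powersetCard.ofFinEmbEquiv.symm s) id).det := by
  -- Expand the image of the rows of `A` under `⋀ᵐ` in the standard basis.
  let φ := exteriorPower.alternatingMapLinearEquiv
    (Matrix.detRowAlternating.compLinearMap B.vecMulLinear)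
  have hφ (v : Fin m → κ → R) :
      φ (exteriorPower.ιMulti R m v) = (Matrix.of v * B).det :=
    exteriorPower.alternatingMapLinearEquiv_apply_ιMulti _ v
  have hφ_basis (s : Set.powersetCard κ m) : φ ((Pi.basisFun R κ).exteriorPower m s) =
      (B.submatrix (Set.powersetCard.ofFinEmbEquiv.symm s) id).det := by
    rw [exteriorPower.coe_basis, exteriorPower.ιMulti_family, hφ]
    congr 1
    ext i j
    simp [Matrix.mul_apply, Pi.single_apply]
  have hexpand := ((Pi.basisFun R κ).exteriorPower m).sum_repr (exteriorPower.ιMulti R m A.row)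
  have hdet : (A * B).det = φ (exteriorPower.ιMulti R m A.row) := (hφ A.row).symm
  rw [hdet, ← hexpand, map_sum]
  refine Finset.sum_congr rfl fun s _ => ?_
  rw [map_smul, smul_eq_mul, hφ_basis, exteriorPower.basis_repr_apply,
    exteriorPower.ιMultiDual_apply_ιMulti]
  rfl

/-- Total positivity relative to a subsemiring `S`, whose elements play the role of the nonnegative
ones: every minor of `A` lies in `S`. -/
def IsTotallyPositive [Preorder ι] [Preorder κ] (S : Subsemiring R) (A : Matrix ι κ R) : Prop :=
  ∀ ⦃m : ℕ⦄ (r : Fin m → ι) (c : Fin m → κ), StrictMono r → StrictMono c →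
    (A.submatrix r c).det ∈ S

namespace IsTotallyPositive

variable {S : Subsemiring R}

theorem transpose [Preorder ι] [Preorder κ] {A : Matrix ι κ R} (hA : IsTotallyPositive S A) :
    IsTotallyPositive S A.transpose := fun m r c hr hc => by
  simpa only [← Matrix.transpose_submatrix, Matrix.det_transpose] using hA c r hc hr

theorem submatrix {ι' κ' : Type*} [Preorder ι] [Preorder κ] [Preorder ι'] [Preorder κ']
    {A : Matrix ι κ R} (hA : IsTotallyPositive S A) {r : ι' → ι} {c : κ' → κ}
    (hr : StrictMono r) (hc : StrictMono c) : IsTotallyPositive S (A.submatrix r c) :=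
  fun _ r' c' hr' hc' => hA (r ∘ r') (c ∘ c') (hr.comp hr') (hc.comp hc')

theorem mul {μ : Type*} [Preorder ι] [Preorder κ] [Fintype μ] [LinearOrder μ]
    {A : Matrix ι μ R} {B : Matrix μ κ R} (hA : IsTotallyPositive S A)
    (hB : IsTotallyPositive S B) : IsTotallyPositive S (A * B) := fun m r c hr hc => by
  rw [Matrix.submatrix_mul A B r id c Function.bijective_id, det_mul_eq_sum_minors]
  exact S.sum_mem fun s _ => S.mul_mem
    (hA r _ hr (Set.powersetCard.ofFinEmbEquiv.symm s).strictMono)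
    (hB _ c (Set.powersetCard.ofFinEmbEquiv.symm s).strictMono hc)

theorem det_submatrix_mem_of_monotone [Preorder ι] [PartialOrder κ] {A : Matrix ι κ R}
    (hA : IsTotallyPositive S A) {m : ℕ} {r : Fin m → ι} {c : Fin m → κ} (hr : StrictMono r)
    (hc : Monotone c) : (A.submatrix r c).det ∈ S := by
  by_cases hinj : Function.Injective c
  · exact hA r c hr (hc.strictMono_of_injective hinj)
  · obtain ⟨i, j, hij, hne⟩ : ∃ i j, c i = c j ∧ i ≠ j := by
      simpa only [Function.Injective, not_forall, exists_prop] using hinj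
    rw [Matrix.det_zero_of_column_eq hne fun k => congrArg (A (r k)) hij]
    exact S.zero_mem

theorem combine_columns {κ' ε : Type*} [Preorder ι] [PartialOrder κ] [Preorder κ'] [Fintype ε]
    {A : Matrix ι κ R} (hA : IsTotallyPositive S A) {w : κ' → ε → R} {p : κ' → ε → κ}
    (hw : ∀ k e, w k e ∈ S) (hp : ∀ k k', k < k' → ∀ e e', p k e ≤ p k' e') :
    IsTotallyPositive S (Matrix.of fun i k => ∑ e, w k e * A i (p k e)) := fun m r c hr hc => by
  classical
  have hexpand : ((Matrix.of fun i k => ∑ e, w k e * A i (p k e)).submatrix r c).det =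
      ∑ x : Fin m → ε, (∏ j, w (c j) (x j)) * (A.submatrix r fun j => p (c j) (x j)).det := by
    have hcols : ((Matrix.of fun i k => ∑ e, w k e * A i (p k e)).submatrix r c).transpose =
        fun j => ∑ e, w (c j) e • fun i => A (r i) (p (c j) e) := by
      ext j i
      simp
    rw [← Matrix.det_transpose, hcols]
    refine (Matrix.detRowAlternating.toMultilinearMap.map_sum _).trans ?_
    refine Finset.sum_congr rfl fun x _ => ?_
    rw [MultilinearMap.map_smul_univ, smul_eq_mul, ← Matrix.det_transpose (A.submatrix r _)]
    rfl
  have hmono (x : Fin m → ε) : Monotone fun j => p (c j) (x j) :=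
    monotone_iff_forall_lt.2 fun j j' hjj' => hp _ _ (hc hjj') _ _
  rw [hexpand]
  exact S.sum_mem fun x _ => S.mul_mem (S.prod_mem fun j _ => hw _ _)
    (hA.det_submatrix_mem_of_monotone hr (hmono x))

theorem of_tail {n : ℕ} {A : Matrix (Fin (n + 1)) ℕ R} (hhead : A 0 = Pi.single 0 1)
    (htail : IsTotallyPositive S (A.submatrix Fin.succ id)) : IsTotallyPositive S A := by
  have hpos {m : ℕ} {r : Fin m → Fin (n + 1)} {c : Fin m → ℕ} (hr : StrictMono r)
      (hc : StrictMono c) (h0 : ∀ i, r i ≠ 0) : (A.submatrix r c).det ∈ S := by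
    have hr' : StrictMono fun i => (r i).pred (h0 i) := fun i j hij => by simpa using hr hij
    simpa [Matrix.submatrix, Function.comp_def] using htail _ c hr' hc
  rintro (_ | m) r c hr hc
  · simp
  have hsucc (j : Fin m) : r j.succ ≠ 0 := (Fin.zero_le _ |>.trans_lt (hr j.succ_pos)).ne'
  by_cases hr0 : r 0 = 0
  · rw [Matrix.det_succ_row_zero, Fin.sum_univ_succ, Finset.sum_eq_zero, add_zero]
    · refine S.mul_mem (S.mul_mem (by simp) ?_) ?_
      · simp only [Matrix.submatrix_apply, hr0, hhead, Pi.single_apply]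
        split_ifs <;> simp
      · exact hpos (hr.comp Fin.strictMono_succ) (hc.comp (Fin.strictMono_succAbove 0)) hsucc
    · intro j _
      have hcj : c j.succ ≠ 0 := (Nat.zero_le _ |>.trans_lt (hc j.succ_pos)).ne'
      simp [hr0, hhead, hcj]
  · exact hpos hr hc <| Fin.cases hr0 hsucc

theorem of_forall_initial_rows [Preorder κ] {A : Matrix ℕ κ R}
    (hA : ∀ n, IsTotallyPositive S (A.submatrix (Fin.val : Fin n → ℕ) id)) :
    IsTotallyPositive S A := fun m r c hr hc => by
  have hlt (i : Fin m) : r i < Finset.univ.sup r + 1 :=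
    Nat.lt_succ_of_le (Finset.le_sup (Finset.mem_univ i))
  exact hA _ (fun i => ⟨r i, hlt i⟩) c (fun i j hij => hr hij) hc

end IsTotallyPositive

end TotalPositivity

/-! ### Weighted lattice paths -/

section PathSum

variable {R : Type*} [CommSemiring R]

/-- The transfer operator of lattice paths on heights `0, 1, 2, …` with steps `±1`: an up step
`h → h + 1` has weight `u h` and a down step `h + 1 → h` has weight `d h`. -/
def pathStep (u d y : ℕ → R) : ℕ → R
  | 0 => d 0 * y 1
  | h + 1 => u h * y h + d (h + 1) * y (h + 2)

/-- The weighted number of lattice paths with `N` steps from height `0` to height `h`. -/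
def pathSum (u d : ℕ → R) : ℕ → ℕ → R
  | 0 => Pi.single 0 1
  | N + 1 => pathStep u d (pathSum u d N)

variable (u d : ℕ → R)

theorem pathStep_succ (y : ℕ → R) (h : ℕ) :
    pathStep u d y (h + 1) = u h * y h + d (h + 1) * y (h + 2) := rfl

theorem pathSum_succ (N : ℕ) : pathSum u d (N + 1) = pathStep u d (pathSum u d N) := rfl

theorem pathSum_eq_zero_of_lt {N h : ℕ} (hlt : N < h) : pathSum u d N h = 0 := by
  induction N generalizing h with
  | zero => exact Pi.single_eq_of_ne hlt.ne' 1
  | succ N ih =>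
    rcases h with _ | h
    · exact absurd hlt (Nat.not_lt_zero _)
    · simp [pathSum, pathStep, ih (h := h) (by lia), ih (h := h + 2) (by lia)]

theorem pathSum_eq_zero_of_odd {N h : ℕ} (hodd : Odd (N + h)) : pathSum u d N h = 0 := by
  induction N generalizing h with
  | zero => exact Pi.single_eq_of_ne (by rintro rfl; simp at hodd) 1
  | succ N ih =>
    rcases h with _ | h
    · simp [pathSum, pathStep, ih (h := 1) (by grind)]
    · simp [pathSum, pathStep, ih (h := h) (by grind), ih (h := h + 2) (by grind)]

theorem map_pathSum {R' : Type*} [CommSemiring R'] (f : R →+* R') (N h : ℕ) :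
    f (pathSum u d N h) = pathSum (f ∘ u) (f ∘ d) N h := by
  induction N generalizing h with
  | zero => rcases h with _ | h <;> simp [pathSum]
  | succ N ih => rcases h with _ | h <;> simp [pathSum, pathStep, ih]

/-- A path from `0` to `h` of length `N` has `(N + h) / 2` up steps. -/
theorem pathSum_smul_up (t : R) (N h : ℕ) :
    pathSum (t • u) d N h = t ^ ((N + h) / 2) * pathSum u d N h := by
  induction N generalizing h with
  | zero => rcases h with _ | h <;> simp [pathSum]
  | succ N ih =>
    rcases h with _ | h
    · simp only [pathSum, pathStep, ih]
      ring
    · have hexp : (N + 1 + (h + 1)) / 2 = (N + h) / 2 + 1 := by lia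
      have hexp' : (N + (h + 2)) / 2 = (N + h) / 2 + 1 := by lia
      simp only [pathSum, pathStep, ih, hexp, hexp', Pi.smul_apply, smul_eq_mul]
      ring

/-- Summation by parts: `pathStep u d` and `pathStep d u` are adjoint up to a boundary term. -/
theorem sum_pathStep_mul (f y : ℕ → R) (K : ℕ) :
    ∑ h ∈ Finset.range (K + 1), pathStep u d f h * y h + u K * f K * y (K + 1) =
      ∑ h ∈ Finset.range (K + 1), f h * pathStep d u y h + d K * f (K + 1) * y K := by
  induction K with
  | zero =>
    simp only [zero_add, Finset.range_one, Finset.sum_singleton, pathStep]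
    ring
  | succ K ih =>
    calc _ = ∑ h ∈ Finset.range (K + 1), pathStep u d f h * y h + u K * f K * y (K + 1) +
          (d (K + 1) * f (K + 2) * y (K + 1) + u (K + 1) * f (K + 1) * y (K + 2)) := by
          rw [Finset.sum_range_succ, pathStep_succ]
          ring
      _ = _ := by
          rw [ih, Finset.sum_range_succ _ (K + 1), pathStep_succ]
          ring

theorem sum_pathSum_succ_mul (N : ℕ) (y : ℕ → R) :
    ∑ h ∈ Finset.range (N + 2), pathSum u d (N + 1) h * y h =
      ∑ h ∈ Finset.range (N + 1), pathSum u d N h * pathStep d u y h := by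
  have hparts := sum_pathStep_mul u d (pathSum u d N) y (N + 1)
  rw [pathSum_eq_zero_of_lt u d (by lia), pathSum_eq_zero_of_lt u d (by lia),
    Finset.sum_range_succ (fun h => pathSum u d N h * _),
    pathSum_eq_zero_of_lt u d (by lia)] at hparts
  simpa only [pathSum_succ, zero_mul, mul_zero, add_zero] using hparts

/-- Reversing the second half of a path exchanges the roles of `u` and `d`. -/
theorem pathSum_add_zero (M N : ℕ) : pathSum d u (M + N) 0 =
    ∑ h ∈ Finset.range (N + 1), pathSum u d N h * pathSum d u M h := by
  induction N generalizing M with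
  | zero => simp [pathSum]
  | succ N ih => rw [sum_pathSum_succ_mul, ← Nat.add_assoc, Nat.add_right_comm, ih, pathSum_succ]

theorem pathSum_two_mul_add_two_mul {j K : ℕ} (hjK : j < K) (i : ℕ) :
    pathSum d u (2 * i + 2 * j) 0 =
      ∑ k ∈ Finset.range K, pathSum d u (2 * i) (2 * k) * pathSum u d (2 * j) (2 * k) := by
  have hextend : ∑ h ∈ Finset.range (2 * j + 1), pathSum u d (2 * j) h * pathSum d u (2 * i) h =
      ∑ h ∈ Finset.range (2 * K), pathSum u d (2 * j) h * pathSum d u (2 * i) h :=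
    Finset.sum_subset (Finset.range_mono (by lia)) fun h _ hh => by
      rw [pathSum_eq_zero_of_lt u d (by simpa using hh), zero_mul]
  rw [pathSum_add_zero, hextend]
  symm
  refine Finset.sum_of_injOn (2 * ·) (mul_right_injective₀ two_ne_zero).injOn
    (fun k hk => by simpa using hk) (fun h hK hh => ?_) fun k _ => mul_comm _ _
  have hodd : Odd h := Nat.not_even_iff_odd.1 fun ⟨k, hk⟩ =>
    hh ⟨k, by simp only [Finset.coe_range, Set.mem_Iio, Finset.mem_range] at hK ⊢; lia, by
      simp only; lia⟩
  rw [pathSum_eq_zero_of_odd u d ((even_two_mul j).add_odd hodd), zero_mul]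

end PathSum

section PathSumTotalPositivity

variable {R : Type*} [CommRing R] {u d : ℕ → R} {S : Subsemiring R}

theorem isTotallyPositive_pathSum_even (hu : ∀ h, u h ∈ S) (hd : ∀ h, d h ∈ S) :
    IsTotallyPositive S (Matrix.of fun n k : ℕ => pathSum u d (2 * n) (2 * k)) := by
  refine .of_forall_initial_rows fun M => ?_
  induction M with
  | zero => exact fun m r _ _ _ => by cases m with
    | zero => simp
    | succ m => exact (r 0).elim0
  | succ M ih =>
    have hodd : IsTotallyPositive S
        (Matrix.of fun (n : Fin M) (k : ℕ) => pathSum u d (2 * n + 1) (2 * k + 1)) := by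
      convert ih.combine_columns (w := fun k => ![u (2 * k), d (2 * k + 1)])
        (p := fun k => ![k, k + 1]) (fun k => by simp [Fin.forall_fin_two, hu, hd])
        (fun k k' hkk' => by
          simp only [Fin.forall_fin_two, Matrix.cons_val_zero, Matrix.cons_val_one]
          lia) using 3
      simp [pathSum_succ, pathStep_succ, mul_add]
    refine .of_tail ?_ ?_
    · ext k
      rcases k with _ | k <;> simp [pathSum]
    · convert hodd.combine_columns
        (w := fun k => ![if k = 0 then 0 else u (2 * k - 1), d (2 * k)])
        (p := fun k => ![k - 1, k]) (fun k => ?_) (fun k k' hkk' => ?_) using 1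
      · ext n k
        rcases k with _ | k <;> simp [pathSum_succ, pathStep, mul_add]
      · by_cases hk : k = 0 <;> simp [Fin.forall_fin_two, hk, hu, hd]
      · simp only [Fin.forall_fin_two, Matrix.cons_val_zero, Matrix.cons_val_one]
        lia

theorem isTotallyPositive_hankel_pathSum (hu : ∀ h, u h ∈ S) (hd : ∀ h, d h ∈ S) :
    IsTotallyPositive S (Matrix.of fun i j : ℕ => pathSum u d (2 * (i + j)) 0) :=
  fun m r c hr hc => by
    let K := Finset.univ.sup c + 1
    have hcK (j : Fin m) : c j < K := Nat.lt_succ_of_le (Finset.le_sup (Finset.mem_univ j))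
    have hfactor : (Matrix.of fun i j : ℕ => pathSum u d (2 * (i + j)) 0).submatrix r c =
        ((Matrix.of fun n k : ℕ => pathSum u d (2 * n) (2 * k)).submatrix id (Fin.val : Fin K → ℕ) *
          ((Matrix.of fun n k : ℕ => pathSum d u (2 * n) (2 * k)).submatrix id
            (Fin.val : Fin K → ℕ)).transpose).submatrix r c := by
      ext i j
      simp [Matrix.mul_apply, mul_add, pathSum_two_mul_add_two_mul d u (hcK j), Finset.sum_range]
    have hP (u d : ℕ → R) (hu : ∀ h, u h ∈ S) (hd : ∀ h, d h ∈ S) :=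
      (isTotallyPositive_pathSum_even hu hd).submatrix strictMono_id (Fin.val_strictMono (n := K))
    rw [hfactor]
    exact ((hP u d hu hd).mul (hP d u hd hu).transpose) r c hr hc

end PathSumTotalPositivity

/-! ### `q`-log-convexity from Hankel minors -/

section QLogConvex

/-- The polynomials with nonnegative coefficients. -/
def nonnegCoeff : Subsemiring ℝ[X] where
  carrier := {f | ∀ j, 0 ≤ f.coeff j}
  mul_mem' {f g} hf hg j := by
    rw [Polynomial.coeff_mul]
    exact Finset.sum_nonneg fun x _ => mul_nonneg (hf _) (hg _)
  one_mem' j := by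
    rw [Polynomial.coeff_one]
    split_ifs <;> norm_num
  add_mem' {f g} hf hg j := by
    rw [Polynomial.coeff_add]
    exact add_nonneg (hf j) (hg j)
  zero_mem' _ := by simp

theorem X_mem_nonnegCoeff : (Polynomial.X : ℝ[X]) ∈ nonnegCoeff := fun j => by
  rw [Polynomial.coeff_X]
  split_ifs <;> norm_num

/-- The contiguous Hankel determinant of order `n` whose top left entry is `f i`. -/
noncomputable def hankelDet (f : ℕ → ℝ[X]) (n i : ℕ) : ℝ[X] :=
  (Matrix.of fun a b : Fin n => f (i + a + b)).det

variable (f : ℕ → ℝ[X])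

theorem hankelDet_one (i : ℕ) : hankelDet f 1 i = f i := by
  simp [hankelDet]

theorem logConvexOp_eq_hankelDet (i : ℕ) : logConvexOp f i = hankelDet f 2 i := by
  simp [logConvexOp, hankelDet, Matrix.det_fin_two, Nat.add_assoc, sq]

theorem logConvexOp_two_eq (i : ℕ) :
    logConvexOp (logConvexOp f) i = f (i + 2) * hankelDet f 3 i := by
  simp only [logConvexOp, Nat.add_assoc, Nat.reduceAdd, hankelDet, Matrix.det_fin_three,
    Matrix.of_apply, Fin.coe_ofNat_eq_mod, Nat.zero_mod, Nat.one_mod, Nat.mod_succ, add_zero,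
    zero_add]
  ring

theorem logConvexOp_three_eq (i : ℕ) :
    logConvexOp (logConvexOp (logConvexOp f)) i = logConvexOp f (i + 2) *
      (hankelDet f 3 i * hankelDet f 3 (i + 2) + f (i + 3) ^ 2 * hankelDet f 4 i) := by
  rw [logConvexOp, logConvexOp_two_eq, logConvexOp_two_eq, logConvexOp_two_eq]
  simp only [hankelDet, Matrix.det_succ_row_zero (n := 3), Matrix.det_fin_three,
    Fin.sum_univ_four, logConvexOp, Matrix.submatrix_apply, Matrix.of_apply, Fin.succAbove,
    Fin.lt_def, Fin.succ, Fin.castSucc, Fin.reduceCastAdd, Fin.coe_ofNat_eq_mod, Nat.reduceMod,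
    Nat.reduceAdd, Nat.reduceLT, if_true, if_false, Nat.add_assoc, zero_add, add_zero]
  ring

variable {f}

theorem isQLogConvex_three_of_hankel
    (hf : IsTotallyPositive nonnegCoeff (Matrix.of fun i j : ℕ => f (i + j))) :
    IsQLogConvex 3 f := by
  have hdet (n i : ℕ) : hankelDet f n i ∈ nonnegCoeff :=
    hf (fun a : Fin n => i + a) Fin.val (fun a b hab => by simpa using hab) Fin.val_strictMono
  have h_one (i : ℕ) : f i ∈ nonnegCoeff := hankelDet_one f i ▸ hdet 1 i
  have h_two (i : ℕ) : logConvexOp f i ∈ nonnegCoeff := logConvexOp_eq_hankelDet f i ▸ hdet 2 i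
  intro m hm i
  change (logConvexOp^[m] f) i ∈ nonnegCoeff
  interval_cases m
  · exact h_one i
  · exact h_two i
  · simp only [Function.iterate_succ, Function.iterate_zero, Function.comp_apply, id_eq,
      logConvexOp_two_eq]
    exact mul_mem (h_one _) (hdet 3 i)
  · simp only [Function.iterate_succ, Function.iterate_zero, Function.comp_apply, id_eq,
      logConvexOp_three_eq]
    exact mul_mem (h_two _) (add_mem (mul_mem (hdet 3 i) (hdet 3 _))
      (mul_mem (pow_mem (h_one _) 2) (hdet 4 i)))

end QLogConvex

/-- The weight of an up step from height `h` in the lattice path model of `cn`. -/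
noncomputable def cnUpWeight (h : ℕ) : ℝ[X] :=
  ((h + 1 : ℕ) : ℝ[X]) * Polynomial.X ^ (if Odd h then 1 else 0)

/-- The Taylor coefficient polynomials of `cn`, as weighted numbers of Dyck paths of length
`2 * n`. -/
noncomputable def cnPoly (n : ℕ) : ℝ[X] :=
  pathSum cnUpWeight (fun h => (h + 1 : ℕ)) (2 * n) 0

theorem isQLogConvex_cnPoly : IsQLogConvex 3 cnPoly :=
  isQLogConvex_three_of_hankel <| isTotallyPositive_hankel_pathSum
    (fun _ => mul_mem (natCast_mem _ _) (pow_mem X_mem_nonnegCoeff _)) (fun _ => natCast_mem _ _)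

/-! ### Partial alternating words -/

section PartialWords

/-- A peak of an alternating word `p₁ > v₁ < p₂ > v₂ < ⋯` together with the valley that follows it;
the peak `⊤` is one whose value is still undetermined. -/
abbrev PeakValley : Type := WithTop ℕ × ℕ

/-- The underlying word `p₁ v₁ p₂ v₂ ⋯` of a list of pairs. -/
def letters (l : List PeakValley) : List (WithTop ℕ) := l.flatMap fun a => [a.1, a.2]

/-- The first letter of a partial word; the empty word counts as starting with an undetermined
peak, since a last valley may be followed by any peak. -/
def firstPeak : List PeakValley → WithTop ℕ
  | [] => ⊤
  | a :: _ => a.1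

/-- A partial word is zigzag if every valley is smaller than the adjacent peaks. -/
def IsZigzag : List PeakValley → Prop
  | [] => True
  | a :: l => (a.2 : WithTop ℕ) < a.1 ∧ (a.2 : WithTop ℕ) < firstPeak l ∧ IsZigzag l

/-- The number of undetermined peaks. -/
def openPeaks (l : List PeakValley) : ℕ := l.countP (·.1 = ⊤)

/-- The number of odd valleys. The letters are counted from `0` here, so these are the minima of
even value. -/
def oddValleys (l : List PeakValley) : ℕ := l.countP (Odd ·.2)

/-- The partial words obtained by adding a letter `N` larger than all letters of `l`: it is either
the value of an undetermined peak, or a new valley, inserted together with a new undetermined peak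
directly before an undetermined peak or at the end. -/
def extensions (N : ℕ) : List PeakValley → List (List PeakValley)
  | [] => [[(⊤, N)]]
  | a :: l => (if a.1 = ⊤ then [((N : WithTop ℕ), a.2) :: l, (⊤, N) :: a :: l] else []) ++
      (extensions N l).map (a :: ·)

/-- The zigzag partial words with letters `0, …, N - 1`. -/
def partialWords : ℕ → List (List PeakValley)
  | 0 => [[]]
  | N + 1 => (partialWords N).flatMap (extensions N)

/-- Remove the letter `N` from a partial word, inverting the two kinds of extensions. -/
def removeLetter (N : ℕ) : List PeakValley → List PeakValley
  | [] => []
  | a :: l => if a.2 = N then l else if a.1 = N then (⊤, a.2) :: l else a :: removeLetter N l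

variable {N : ℕ} {l c : List PeakValley}

theorem letters_cons (a : PeakValley) : letters (a :: l) = a.1 :: (a.2 : WithTop ℕ) :: letters l :=
  rfl

theorem mem_extensions_cons {a : PeakValley} : c ∈ extensions N (a :: l) ↔
    (a.1 = ⊤ ∧ (c = ((N : WithTop ℕ), a.2) :: l ∨ c = (⊤, N) :: a :: l)) ∨
      ∃ c' ∈ extensions N l, a :: c' = c := by
  by_cases ha : a.1 = ⊤ <;> simp [extensions, ha, or_assoc]

theorem fill_mem_extensions (N v : ℕ) (l : List PeakValley) :
    ((N : WithTop ℕ), v) :: l ∈ extensions N ((⊤, v) :: l) :=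
  mem_extensions_cons.2 (.inl ⟨rfl, .inl rfl⟩)

theorem insert_mem_extensions (N : ℕ) (hl : firstPeak l = ⊤) : (⊤, N) :: l ∈ extensions N l := by
  cases l with
  | nil => exact List.mem_singleton_self _
  | cons a l => exact mem_extensions_cons.2 (.inl ⟨hl, .inr rfl⟩)

theorem cons_mem_extensions (a : PeakValley) (hc : c ∈ extensions N l) :
    a :: c ∈ extensions N (a :: l) :=
  mem_extensions_cons.2 (.inr ⟨c, hc, rfl⟩)

@[elab_as_elim]
theorem extensions_induction {motive : ∀ l c, c ∈ extensions N l → Prop}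
    (fill : ∀ v l, motive ((⊤, v) :: l) (((N : WithTop ℕ), v) :: l) (fill_mem_extensions N v l))
    (insert : ∀ l (hl : firstPeak l = ⊤), motive l ((⊤, N) :: l) (insert_mem_extensions N hl))
    (cons : ∀ a l c (hc : c ∈ extensions N l), motive l c hc →
      motive (a :: l) (a :: c) (cons_mem_extensions a hc))
    (hc : c ∈ extensions N l) : motive l c hc := by
  induction l generalizing c with
  | nil =>
    obtain rfl := List.mem_singleton.1 hc
    exact insert [] rfl
  | cons a l ih =>
    obtain ⟨p, v⟩ := a
    rcases mem_extensions_cons.1 hc with ⟨rfl, rfl | rfl⟩ | ⟨c, hc', rfl⟩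
    · exact fill v l
    · exact insert _ rfl
    · exact cons _ l c hc' (ih hc')

theorem count_letters_extensions (hc : c ∈ extensions N l) (i : ℕ) :
    (letters c).count (i : WithTop ℕ) =
      (letters l).count (i : WithTop ℕ) + if i = N then 1 else 0 := by
  induction hc using extensions_induction with
  | fill v l | insert l _ =>
    simp only [letters_cons, List.count_cons, beq_iff_eq, Nat.cast_inj, WithTop.top_ne_natCast,
      if_false, eq_comm (a := N)]
    ring
  | cons a l c _ ih =>
    simp only [letters_cons, List.count_cons, ih]
    ring

theorem firstPeak_extensions (hc : c ∈ extensions N l) :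
    firstPeak c = firstPeak l ∨ (firstPeak l = ⊤ ∧ firstPeak c = N) := by
  induction hc using extensions_induction with
  | fill v l => exact .inr ⟨rfl, rfl⟩
  | insert l hl => exact .inl hl.symm
  | cons a l c _ _ => exact .inl rfl

theorem IsZigzag.of_mem_extensions (hl : IsZigzag l)
    (hN : ∀ i : ℕ, (i : WithTop ℕ) ∈ letters l → i < N) (hc : c ∈ extensions N l) :
    IsZigzag c := by
  induction hc using extensions_induction with
  | fill v l => exact ⟨Nat.cast_lt.2 (hN v (by simp [letters_cons])), hl.2⟩
  | insert l hpeak =>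
    exact ⟨WithTop.natCast_lt_top N, (WithTop.natCast_lt_top N).trans_eq hpeak.symm, hl⟩
  | cons a l c hc ih =>
    refine ⟨hl.1, ?_, ih hl.2.2 fun i hi => hN i (by simp [letters_cons, hi])⟩
    rcases firstPeak_extensions hc with h | ⟨-, h⟩ <;> rw [h]
    · exact hl.2.1
    · exact Nat.cast_lt.2 (hN a.2 (by simp [letters_cons]))

theorem removeLetter_extensions (hN : (N : WithTop ℕ) ∉ letters l) (hc : c ∈ extensions N l) :
    removeLetter N c = l := by
  induction hc using extensions_induction with
  | fill v l =>
    have hv : v ≠ N := by rintro rfl; simp [letters_cons] at hN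
    simp [removeLetter, hv]
  | insert l _ => simp [removeLetter]
  | cons a l c _ ih =>
    simp only [letters_cons, List.mem_cons, Nat.cast_inj, not_or] at hN
    simp [removeLetter, Ne.symm hN.1, Ne.symm hN.2.1, ih hN.2.2]

theorem nodup_extensions (hN : (N : WithTop ℕ) ∉ letters l) : (extensions N l).Nodup := by
  induction l with
  | nil => exact List.nodup_singleton _
  | cons a l ih =>
    simp only [letters_cons, List.mem_cons, Nat.cast_inj, not_or] at hN
    refine List.nodup_append.2 ⟨by split_ifs <;> simp, (ih hN.2.2).map List.cons_injective,
      fun x hx y hy hxy => ?_⟩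
    obtain ⟨c, -, rfl⟩ := List.mem_map.1 hy
    split_ifs at hx with hpeak
    · rcases List.mem_pair.1 hx with rfl | rfl
      · exact hN.1 (congrArg firstPeak hxy)
      · exact hN.2.1 (congrArg Prod.snd (List.cons.inj hxy).1)
    · exact List.not_mem_nil hx

theorem exists_mem_extensions (hc : IsZigzag c) (hcount : (letters c).count (N : WithTop ℕ) = 1)
    (hmax : ∀ i : ℕ, (i : WithTop ℕ) ∈ letters c → i ≤ N) :
    ∃ l, IsZigzag l ∧ c ∈ extensions N l := by
  induction c with
  | nil => simp [letters] at hcount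
  | cons a c ih =>
    obtain ⟨p, v⟩ := a
    obtain ⟨hvp, hvc, hc⟩ := hc
    have htop (q : WithTop ℕ) (hq : q = ⊤ ∨ q ∈ letters ((p, v) :: c)) (hNq : N < q) : q = ⊤ := by
      by_contra hne
      lift q to ℕ using hne
      exact (Nat.cast_lt.1 hNq).not_ge (hmax q (hq.resolve_left WithTop.coe_ne_top))
    by_cases hv : v = N
    · subst hv
      have hpeak : firstPeak c = ⊤ := by
        refine htop _ ?_ hvc
        cases c with
        | nil => exact .inl rfl
        | cons b c => exact .inr (by simp [letters_cons, firstPeak])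
      obtain rfl : p = ⊤ := htop p (.inr (by simp [letters_cons])) hvp
      exact ⟨c, hc, insert_mem_extensions _ hpeak⟩
    by_cases hp : p = N
    · subst hp
      exact ⟨(⊤, v) :: c, ⟨WithTop.natCast_lt_top v, hvc, hc⟩,
        fill_mem_extensions _ v c⟩
    · obtain ⟨l, hl, hlc⟩ := ih hc (by simpa [letters_cons, List.count_cons, hv, hp] using hcount)
        fun i hi => hmax i (by simp [letters_cons, hi])
      refine ⟨(p, v) :: l, ⟨hvp, ?_, hl⟩, cons_mem_extensions _ hlc⟩
      rcases firstPeak_extensions hlc with h | ⟨h, -⟩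
      · exact hvc.trans_eq h
      · exact (WithTop.natCast_lt_top v).trans_eq h.symm

theorem mem_partialWords : l ∈ partialWords N ↔
    IsZigzag l ∧ ∀ i : ℕ, (letters l).count (i : WithTop ℕ) = if i < N then 1 else 0 := by
  have hlt {M : ℕ} {l : List PeakValley}
      (h : ∀ i : ℕ, (letters l).count (i : WithTop ℕ) = if i < M then 1 else 0) (i : ℕ)
      (hi : (i : WithTop ℕ) ∈ letters l) : i < M := by
    by_contra hM
    simpa [h, hM] using List.count_pos_iff.2 hi
  induction N generalizing l with
  | zero =>
    refine ⟨fun hl => ?_, fun ⟨_, hcount⟩ => ?_⟩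
    · obtain rfl := List.mem_singleton.1 hl
      exact ⟨trivial, fun _ => rfl⟩
    · rcases l with _ | ⟨a, l⟩
      · exact List.mem_singleton_self _
      · simpa [letters_cons] using hlt hcount a.2
  | succ N ih =>
    simp only [partialWords, List.mem_flatMap, ih]
    constructor
    · rintro ⟨l', ⟨hl', hcount⟩, hl⟩
      refine ⟨hl'.of_mem_extensions (hlt hcount) hl, fun i => ?_⟩
      rw [count_letters_extensions hl, hcount]
      grind
    · rintro ⟨hl, hcount⟩
      obtain ⟨l', hl', hll'⟩ := exists_mem_extensions (N := N) hl (by simp [hcount])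
        fun i hi => Nat.le_of_lt_succ (hlt hcount i hi)
      refine ⟨l', ⟨hl', fun i => ?_⟩, hll'⟩
      have hadd := count_letters_extensions hll' i
      rw [hcount] at hadd
      grind

theorem nodup_partialWords (N : ℕ) : (partialWords N).Nodup := by
  induction N with
  | zero => exact List.nodup_singleton _
  | succ N ih =>
    have hnotMem (l) (hl : l ∈ partialWords N) : (N : WithTop ℕ) ∉ letters l :=
      List.count_eq_zero.1 (by simp [(mem_partialWords.1 hl).2])
    refine List.nodup_flatMap.2 ⟨fun l hl => nodup_extensions (hnotMem l hl),
      ih.pairwise_of_forall_ne fun l hl l' hl' hne c hc hc' => hne ?_⟩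
    rw [← removeLetter_extensions (hnotMem l hl) hc, removeLetter_extensions (hnotMem l' hl') hc']

theorem openPeaks_cons (a : PeakValley) :
    openPeaks (a :: l) = openPeaks l + if a.1 = ⊤ then 1 else 0 := by
  simp [openPeaks, List.countP_cons]

theorem oddValleys_cons (a : PeakValley) :
    oddValleys (a :: l) = oddValleys l + if Odd a.2 then 1 else 0 := by
  simp [oddValleys, List.countP_cons]

theorem sum_map_extensions {R : Type*} [AddCommMonoid R] (N : ℕ) (l : List PeakValley)
    (F : ℕ → ℕ → R) :
    ((extensions N l).map fun c => F (openPeaks c) (oddValleys c)).sum =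
      openPeaks l • F (openPeaks l - 1) (oddValleys l) + (openPeaks l + 1) •
        F (openPeaks l + 1) (oddValleys l + if Odd N then 1 else 0) := by
  induction l generalizing F with
  | nil => simp [extensions, openPeaks, oddValleys, List.countP_cons]
  | cons a l ih =>
    have htail := ih fun h k => F (h + if a.1 = ⊤ then 1 else 0) (k + if Odd a.2 then 1 else 0)
    simp only [← openPeaks_cons, ← oddValleys_cons] at htail
    by_cases ha : a.1 = ⊤
    · have hfill : openPeaks l • F (openPeaks l - 1 + 1) (oddValleys (a :: l)) =
          openPeaks l • F (openPeaks l) (oddValleys (a :: l)) := by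
        rcases openPeaks l with _ | h <;> simp
      simp only [extensions, ha, if_true, List.map_append, List.sum_append, List.map_map,
        Function.comp_def, htail, hfill]
      simp only [List.map_cons, List.map_nil, List.sum_cons, List.sum_nil, openPeaks_cons,
        oddValleys_cons, ha, WithTop.natCast_ne_top, if_true, if_false, add_zero, add_right_comm,
        Nat.add_sub_cancel, add_smul, one_smul]
      abel
    · simp only [extensions, ha, if_false, List.map_append, List.sum_append, List.map_map,
        Function.comp_def, htail]
      simp only [List.map_nil, List.sum_nil, openPeaks_cons, oddValleys_cons, ha, if_false,
        add_zero, zero_add, add_right_comm]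

/-- The generating polynomial, by odd valleys, of the zigzag partial words with letters
`0, …, N - 1` and `h` undetermined peaks. -/
noncomputable def wordPolynomial (N h : ℕ) : ℝ[X] :=
  ((partialWords N).map fun l => if openPeaks l = h then Polynomial.X ^ oddValleys l else 0).sum

theorem wordPolynomial_succ (N h : ℕ) : wordPolynomial (N + 1) h =
    (h + 1) • wordPolynomial N (h + 1) +
      h • (Polynomial.X ^ (if Odd N then 1 else 0) * wordPolynomial N (h - 1)) := by
  simp only [wordPolynomial, partialWords]
  induction partialWords N with
  | nil => simp
  | cons l L ih =>
    rw [List.flatMap_cons, List.map_append, List.sum_append, ih,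
      sum_map_extensions N l fun o k => if o = h then (Polynomial.X : ℝ[X]) ^ k else 0]
    have hfill : openPeaks l • (if openPeaks l - 1 = h then Polynomial.X ^ oddValleys l else 0) =
        (h + 1) • (if openPeaks l = h + 1 then Polynomial.X ^ oddValleys l else (0 : ℝ[X])) := by
      rcases openPeaks l with _ | o
      · simp
      · by_cases ho : o = h <;> simp [ho]
    have hinsert : (openPeaks l + 1) • (if openPeaks l + 1 = h then
          Polynomial.X ^ (oddValleys l + if Odd N then 1 else 0) else 0) =
        h • (Polynomial.X ^ (if Odd N then 1 else 0) *
          if openPeaks l = h - 1 then Polynomial.X ^ oddValleys l else (0 : ℝ[X])) := by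
      rcases h with _ | h
      · simp
      · by_cases ho : openPeaks l = h <;> simp [ho, pow_add, mul_comm]
    rw [hfill, hinsert, List.map_cons, List.map_cons, List.sum_cons, List.sum_cons, mul_add,
      smul_add, smul_add]
    abel

theorem wordPolynomial_eq_pathSum (N h : ℕ) :
    wordPolynomial N h = pathSum cnUpWeight (fun h => (h + 1 : ℕ)) N h := by
  induction N generalizing h with
  | zero =>
    rcases h with _ | h <;> simp [wordPolynomial, partialWords, openPeaks, oddValleys, pathSum]
  | succ N ih =>
    rw [wordPolynomial_succ]
    rcases h with _ | h
    · simp [pathSum_succ, pathStep, ih]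
    -- Paths of length `N` only reach heights of the parity of `N`.
    have hparity : Polynomial.X ^ (if Odd N then 1 else 0) * wordPolynomial N h =
        Polynomial.X ^ (if Odd h then 1 else 0) * wordPolynomial N h := by
      by_cases hodd : Odd (N + h)
      · simp [ih, pathSum_eq_zero_of_odd _ _ hodd]
      · rw [Nat.not_odd_iff_even, Nat.even_add'] at hodd
        simp only [hodd]
    rw [Nat.add_sub_cancel, hparity, ih, ih, pathSum_succ, pathStep_succ, cnUpWeight,
      nsmul_eq_mul, nsmul_eq_mul]
    ring

theorem cnPoly_eq_wordPolynomial (n : ℕ) : cnPoly n = wordPolynomial (2 * n) 0 :=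
  (wordPolynomial_eq_pathSum _ _).symm

/-! ### Alternating permutations as closed partial words -/

/-- The word of a permutation of `{0, …, 2 n - 1}`, cut into consecutive pairs. -/
def pairWord {n : ℕ} (σ : Equiv.Perm (Fin (2 * n))) : List PeakValley :=
  List.ofFn fun j : Fin n =>
    (((σ ⟨2 * j, by lia⟩ : ℕ) : WithTop ℕ), (σ ⟨2 * j + 1, by lia⟩ : ℕ))

theorem letters_injective : Function.Injective letters := by
  intro l l' h
  induction l generalizing l' with
  | nil => cases l' with
    | nil => rfl
    | cons b l' => cases h
  | cons a l ih => cases l' with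
    | nil => cases h
    | cons b l' =>
      simp only [letters_cons, List.cons.injEq, Nat.cast_inj] at h
      rw [Prod.ext h.1 h.2.1, ih h.2.2]

theorem count_top_letters (l : List PeakValley) : (letters l).count ⊤ = openPeaks l := by
  induction l with
  | nil => rfl
  | cons a l ih => simp [letters_cons, openPeaks_cons, List.count_cons, ih]

theorem count_ofFn_natCast (N i : ℕ) :
    (List.ofFn fun j : Fin N => ((j : ℕ) : WithTop ℕ)).count (i : WithTop ℕ) =
      if i < N then 1 else 0 := by
  have hnodup : (List.ofFn fun j : Fin N => ((j : ℕ) : WithTop ℕ)).Nodup :=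
    List.nodup_ofFn.2 fun j j' h => Fin.ext (Nat.cast_inj.1 h)
  simp [hnodup.count, List.mem_ofFn', Fin.exists_iff]

theorem closed_mem_partialWords : l ∈ partialWords N ∧ openPeaks l = 0 ↔
    IsZigzag l ∧ (letters l).Perm (List.ofFn fun j : Fin N => ((j : ℕ) : WithTop ℕ)) := by
  have htop : (List.ofFn fun j : Fin N => ((j : ℕ) : WithTop ℕ)).count ⊤ = 0 :=
    List.count_eq_zero.2 (by simp [List.mem_ofFn'])
  rw [mem_partialWords, and_assoc, List.perm_iff_count, ← count_top_letters]
  refine and_congr_right fun _ => ⟨fun ⟨hcount, hclosed⟩ a => ?_, fun h => ⟨fun i => ?_, ?_⟩⟩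
  · induction a using WithTop.recTopCoe with
    | top => rw [hclosed, htop]
    | coe i => exact (hcount i).trans (count_ofFn_natCast N i).symm
  · rw [h, count_ofFn_natCast]
  · rw [h, htop]

theorem exists_perm_ofFn_comp_eq {A : Type*} {f : Fin N → A} (hf : Function.Injective f)
    {w : List A} (hw : w.Perm (List.ofFn f)) :
    ∃ σ : Equiv.Perm (Fin N), List.ofFn (f ∘ σ) = w := by
  obtain rfl : w.length = N := by simpa using hw.length_eq
  have hmem (i : Fin w.length) : ∃ j, f j = w[i] :=
    (List.mem_ofFn' _ _).1 (hw.mem_iff.1 (List.getElem_mem i.2))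
  choose σ hσ using hmem
  have hinj : Function.Injective σ := fun i j hij => by
    have hnodup : w.Nodup := hw.nodup_iff.2 (List.nodup_ofFn.2 hf)
    exact hnodup.injective_get ((hσ i).symm.trans ((congrArg f hij).trans (hσ j)))
  refine ⟨Equiv.ofBijective σ (Finite.injective_iff_bijective.1 hinj), ?_⟩
  exact (congrArg List.ofFn (funext hσ)).trans (List.ofFn_get w)

theorem countP_ofFn {A : Type*} (p : A → Prop) [DecidablePred p] (f : Fin N → A) :
    (List.ofFn f).countP p = Set.ncard {i | p (f i)} := by
  rw [List.ofFn_eq_map, List.countP_map, List.countP_eq_length_filter, Set.ncard_eq_toFinset_card',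
    Set.toFinset_ofPred]
  rfl

theorem coeff_sum_map_ite_X_pow {A : Type*} (L : List A) (p : A → Prop) [DecidablePred p]
    (e : A → ℕ) (k : ℕ) :
    ((L.map fun x => if p x then (Polynomial.X : ℝ[X]) ^ e x else 0).sum).coeff k =
      (L.countP fun x => p x ∧ e x = k : ℝ) := by
  induction L with
  | nil => simp
  | cons x L ih =>
    rw [List.map_cons, List.sum_cons, Polynomial.coeff_add, ih, List.countP_cons]
    by_cases hp : p x <;> by_cases he : e x = k <;>
      simp [hp, he, Polynomial.coeff_X_pow, eq_comm (a := k), add_comm]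

theorem isZigzag_iff_getElem : IsZigzag l ↔
    (∀ (i : ℕ) (hi : i < l.length), ((l[i].2 : ℕ) : WithTop ℕ) < l[i].1) ∧
      ∀ (i : ℕ) (hi : i + 1 < l.length), ((l[i].2 : ℕ) : WithTop ℕ) < l[i + 1].1 := by
  induction l with
  | nil => simp [IsZigzag]
  | cons a l ih =>
    have hpeak : (a.2 : WithTop ℕ) < firstPeak l ↔
        ∀ h : 0 < l.length, (a.2 : WithTop ℕ) < l[0].1 := by
      cases l <;> simp [firstPeak]
    rw [IsZigzag, ih, hpeak]
    constructor
    · rintro ⟨hhead, hhead_next, hpair, hnext⟩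
      exact ⟨fun
        | 0, _ => hhead
        | i + 1, hi => hpair i (Nat.lt_of_succ_lt_succ hi), fun
        | 0, hi => hhead_next (Nat.lt_of_succ_lt_succ hi)
        | i + 1, hi => hnext i (Nat.lt_of_succ_lt_succ hi)⟩
    · rintro ⟨hpair, hnext⟩
      exact ⟨hpair 0 (Nat.succ_pos _), fun hi => hnext 0 (Nat.succ_lt_succ hi),
        fun i hi => hpair (i + 1) (Nat.succ_lt_succ hi),
        fun i hi => hnext (i + 1) (Nat.succ_lt_succ hi)⟩

section PairWord

variable {n : ℕ} {σ : Equiv.Perm (Fin (2 * n))}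

theorem letters_pairWord :
    letters (pairWord σ) = List.ofFn ((fun j : Fin (2 * n) => ((j : ℕ) : WithTop ℕ)) ∘ σ) := by
  rw [List.ofFn_mul', letters, List.flatMap, pairWord, List.map_ofFn]
  rfl

theorem pairWord_injective : Function.Injective (pairWord (n := n)) := fun σ τ h => by
  have hletters := congrArg letters h
  rw [letters_pairWord, letters_pairWord] at hletters
  exact Equiv.ext fun i => Fin.ext (Nat.cast_inj.1 (congrFun (List.ofFn_injective hletters) i))

theorem isZigzag_pairWord : IsZigzag (pairWord σ) ↔ IsAlternatingPerm σ := by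
  rw [isZigzag_iff_getElem]
  simp only [pairWord, List.length_ofFn, List.getElem_ofFn, Nat.cast_lt, Fin.val_fin_lt]
  constructor
  · rintro ⟨hpair, hnext⟩ i j hij
    refine ⟨fun ⟨m, hm⟩ => ?_, fun ⟨m, hm⟩ => ?_⟩
    · convert hpair m (by lia) using 2 <;> ext <;> simp <;> lia
    · convert hnext m (by lia) using 2 <;> ext <;> simp <;> lia
  · intro h
    refine ⟨fun i hi => (h _ _ rfl).1 (by simp), fun i hi => (h _ _ ?_).2 (by simp)⟩
    simp only
    ring

theorem closed_mem_partialWords_iff_exists_perm : l ∈ partialWords (2 * n) ∧ openPeaks l = 0 ↔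
    ∃ σ : Equiv.Perm (Fin (2 * n)), IsAlternatingPerm σ ∧ pairWord σ = l := by
  rw [closed_mem_partialWords]
  constructor
  · rintro ⟨hzigzag, hperm⟩
    obtain ⟨σ, hσ⟩ := exists_perm_ofFn_comp_eq (fun i j h => Fin.ext (Nat.cast_inj.1 h)) hperm
    obtain rfl : pairWord σ = l := letters_injective (letters_pairWord.trans hσ)
    exact ⟨σ, isZigzag_pairWord.1 hzigzag, rfl⟩
  · rintro ⟨σ, hσ, rfl⟩
    exact ⟨isZigzag_pairWord.2 hσ, letters_pairWord ▸ σ.ofFn_comp_perm _⟩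

theorem isPermMinimum_iff_odd (hσ : IsAlternatingPerm σ) (i : Fin (2 * n)) :
    IsPermMinimum σ i ↔ Odd (i : ℕ) := by
  refine ⟨fun hmin => Nat.not_even_iff_odd.1 fun heven => ?_, ?_⟩
  · have hlt : (i : ℕ) + 1 < 2 * n := by grind
    exact lt_asymm (hmin ⟨i + 1, hlt⟩ (.inl rfl)) ((hσ i ⟨i + 1, hlt⟩ rfl).1 heven)
  · rintro hodd j (hj | hj)
    · exact (hσ i j hj).2 hodd
    · exact (hσ j i hj).1 (by grind)

theorem oddValleys_pairWord (hσ : IsAlternatingPerm σ) :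
    oddValleys (pairWord σ) = evenMinimaCount σ := by
  let pos (j : Fin n) : Fin (2 * n) := ⟨2 * j + 1, by lia⟩
  have hpos : Function.Injective pos := fun j j' h => by
    simp only [pos, Fin.mk.injEq] at h
    lia
  have himage : {i : Fin (2 * n) | IsPermMinimum σ i ∧ Even ((σ i : ℕ) + 1)} =
      pos '' {j | Odd (σ (pos j) : ℕ)} := by
    ext i
    simp only [Set.mem_ofPred_eq, isPermMinimum_iff_odd hσ, Nat.even_add_one, Nat.not_even_iff_odd,
      Set.mem_image]
    refine ⟨fun ⟨⟨j, hj⟩, hi⟩ => ?_, ?_⟩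
    · have hji : pos ⟨j, by lia⟩ = i := Fin.ext hj.symm
      exact ⟨⟨j, by lia⟩, by rwa [hji], hji⟩
    · rintro ⟨j, hj, rfl⟩
      exact ⟨odd_two_mul_add_one _, hj⟩
  rw [evenMinimaCount, himage, Set.ncard_image_of_injective _ hpos, oddValleys, pairWord,
    countP_ofFn]

theorem coeff_cnPoly (n k : ℕ) : (cnPoly n).coeff k =
    (Nat.card {σ : Equiv.Perm (Fin (2 * n)) //
      IsAlternatingPerm σ ∧ evenMinimaCount σ = k} : ℝ) := by
  let L := (partialWords (2 * n)).filter fun l => openPeaks l = 0 ∧ oddValleys l = k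
  have hcoeff : (cnPoly n).coeff k = L.toFinset.card := by
    rw [cnPoly_eq_wordPolynomial, wordPolynomial, coeff_sum_map_ite_X_pow,
      List.toFinset_card_of_nodup ((nodup_partialWords _).filter _), List.countP_eq_length_filter]
  have hmem (l) : l ∈ L.toFinset ↔ ∃ σ : Equiv.Perm (Fin (2 * n)),
      (IsAlternatingPerm σ ∧ evenMinimaCount σ = k) ∧ pairWord σ = l := by
    rw [List.mem_toFinset, List.mem_filter, decide_eq_true_iff, ← and_assoc,
      closed_mem_partialWords_iff_exists_perm]
    grind [oddValleys_pairWord]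
  have himage : (L.toFinset : Set (List PeakValley)) = pairWord '' {σ : Equiv.Perm (Fin (2 * n)) |
      IsAlternatingPerm σ ∧ evenMinimaCount σ = k} := Set.ext hmem
  rw [hcoeff, ← Set.ncard_coe_finset, himage, Set.ncard_image_of_injective _ pairWord_injective]
  rfl

end PairWord

end PartialWords

/-! ### Taylor series -/

open scoped ContDiff in
theorem hasSum_taylor_of_abs_iteratedDeriv_le {f : ℝ → ℝ} (hf : ContDiff ℝ ∞ f) {x₀ x C r : ℝ}
    (hr : 0 ≤ r) (hrx : r * |x - x₀| < 1)
    (hbound : ∀ n, ∀ t ∈ Set.uIcc x₀ x, |iteratedDeriv n f t| ≤ C * r ^ n * n.factorial) :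
    HasSum (fun n => iteratedDeriv n f x₀ * (x - x₀) ^ n / n.factorial) (f x) := by
  have hgeom := summable_geometric_of_lt_one (mul_nonneg hr (abs_nonneg _)) hrx
  have hterm (n : ℕ) {t : ℝ} (ht : t ∈ Set.uIcc x₀ x) :
      |iteratedDeriv n f t * (x - x₀) ^ n / n.factorial| ≤ C * (r * |x - x₀|) ^ n := by
    rw [abs_div, abs_mul, abs_pow, Nat.abs_cast, div_le_iff₀ (by positivity)]
    calc _ ≤ C * r ^ n * n.factorial * |x - x₀| ^ n := by gcongr; exact hbound n t ht
      _ = _ := by ring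
  have hsummable : Summable fun n => iteratedDeriv n f x₀ * (x - x₀) ^ n / n.factorial :=
    .of_norm_bounded (hgeom.mul_left C) fun n => hterm n Set.left_mem_uIcc
  rw [hsummable.hasSum_iff_tendsto_nat, ← Filter.tendsto_add_atTop_iff_nat 1,
    tendsto_iff_norm_sub_tendsto_zero]
  refine squeeze_zero (fun _ => norm_nonneg _) (fun n => ?_)
    (((hgeom.mul_left C).tendsto_atTop_zero).comp (Filter.tendsto_add_atTop_nat 1))
  rcases eq_or_ne x₀ x with rfl | hx
  · simp [Finset.sum_range_succ']
  obtain ⟨t, ht, hrem⟩ := taylor_mean_remainder_lagrange_iteratedDeriv (n := n) hx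
    (hf.of_le (mod_cast le_top)).contDiffOn
  have htaylor : ∑ k ∈ Finset.range (n + 1), iteratedDeriv k f x₀ * (x - x₀) ^ k / k.factorial =
      taylorWithinEval f n (Set.uIcc x₀ x) x₀ x := by
    rw [taylor_within_apply]
    refine Finset.sum_congr rfl fun k _ => ?_
    rw [iteratedDerivWithin_eq_iteratedDeriv (uniqueDiffOn_uIcc hx)
      (hf.of_le (mod_cast le_top)).contDiffAt Set.left_mem_uIcc, smul_eq_mul]
    ring
  rw [htaylor, norm_sub_rev, hrem, Real.norm_eq_abs]
  exact hterm (n + 1) (Set.Ioo_subset_Icc_self ht)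

theorem eq_of_hasSum_evenPowerSeries {a b : ℕ → ℝ} {f : ℝ → ℝ}
    (ha : ∀ᶠ u in nhds (0 : ℝ), HasSum (fun n => a n * u ^ (2 * n)) (f u))
    (hb : ∀ᶠ u in nhds (0 : ℝ), HasSum (fun n => b n * u ^ (2 * n)) (f u)) : a = b := by
  let series (a : ℕ → ℝ) := FormalMultilinearSeries.ofScalars ℝ fun m =>
    if Even m then a (m / 2) else 0
  have hseries {a : ℕ → ℝ} (ha : ∀ᶠ u in nhds (0 : ℝ), HasSum (fun n => a n * u ^ (2 * n)) (f u)) :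
      HasFPowerSeriesAt f (series a) 0 := by
    rw [hasFPowerSeriesAt_iff]
    filter_upwards [ha] with u hu
    rw [zero_add, ← (mul_right_injective₀ (two_ne_zero' ℕ)).hasSum_iff fun m hm => ?_]
    · simpa [Function.comp_def, series, mul_comm] using hu
    · have hodd : ¬ Even m := fun heven => hm (heven.exists_two_nsmul.imp fun _ h => h.symm)
      simp [series, hodd]
  have hcoeff (n : ℕ) : (series a).coeff (2 * n) = (series b).coeff (2 * n) :=
    congrArg (FormalMultilinearSeries.coeff · _)
      ((hseries ha).eq_formalMultilinearSeries (hseries hb))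
  exact funext fun n => by simpa [series] using hcoeff n

/-! ### Taylor coefficients as path sums -/

section PathSumDeriv

variable {u d : ℕ → ℝ}

theorem abs_pathSum_le {u' d' : ℕ → ℝ} (hu : ∀ h, |u h| ≤ u' h) (hd : ∀ h, |d h| ≤ d' h)
    (N h : ℕ) : |pathSum u d N h| ≤ pathSum u' d' N h := by
  have hmul {a b a' b' : ℝ} (ha : |a| ≤ a') (hb : |b| ≤ b') : |a * b| ≤ a' * b' :=
    (abs_mul a b).trans_le (mul_le_mul ha hb (abs_nonneg b) ((abs_nonneg a).trans ha))
  induction N generalizing h with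
  | zero => rcases h with _ | h <;> simp [pathSum]
  | succ N ih =>
    rcases h with _ | h
    · exact hmul (hd 0) (ih 1)
    · exact (abs_add_le _ _).trans
        (add_le_add (hmul (hu h) (ih h)) (hmul (hd (h + 1)) (ih (h + 2))))

theorem sum_pathSum_succ_le (N : ℕ) :
    ∑ h ∈ Finset.range (N + 1), pathSum (fun h => (h + 1 : ℝ)) (fun h => (h + 1 : ℝ)) N h ≤
      2 ^ N * N.factorial := by
  set w : ℕ → ℝ := fun h => h + 1
  have hw (h) : |w h| ≤ w h := (abs_of_nonneg (by positivity : 0 ≤ w h)).le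
  induction N with
  | zero => simp [pathSum]
  | succ N ih =>
    have hsum := sum_pathSum_succ_mul w w N 1
    simp only [Pi.one_apply, mul_one] at hsum
    have hstep (h : ℕ) (hh : h ∈ Finset.range (N + 1)) : pathStep w w 1 h ≤ 2 * (N + 1) := by
      have hN : (h : ℝ) ≤ N := by exact_mod_cast Finset.mem_range_succ_iff.1 hh
      rcases h with _ | h
      · simp only [pathStep, w, Pi.one_apply, Nat.cast_zero]
        linarith
      · simp only [pathStep, w, Pi.one_apply, Nat.cast_add_one] at hN ⊢
        linarith
    calc ∑ h ∈ Finset.range (N + 2), pathSum w w (N + 1) h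
        = ∑ h ∈ Finset.range (N + 1), pathSum w w N h * pathStep w w 1 h := hsum
      _ ≤ ∑ h ∈ Finset.range (N + 1), pathSum w w N h * (2 * (N + 1)) :=
        Finset.sum_le_sum fun h hh => mul_le_mul_of_nonneg_left (hstep h hh)
          ((abs_nonneg _).trans (abs_pathSum_le hw hw N h))
      _ ≤ 2 ^ N * N.factorial * (2 * (N + 1)) := by
        rw [← Finset.sum_mul]
        gcongr
      _ = 2 ^ (N + 1) * (N + 1).factorial := by
        rw [Nat.factorial_succ]
        push_cast
        ring

variable {b : ℕ → ℝ → ℝ}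

theorem iteratedDeriv_eq_sum_pathSum
    (hb : ∀ h x, HasDerivAt (b h) (pathStep d u (fun k => b k x) h) x) (N : ℕ) :
    iteratedDeriv N (b 0) = fun x => ∑ h ∈ Finset.range (N + 1), pathSum u d N h * b h x := by
  induction N with
  | zero => simp [pathSum]
  | succ N ih =>
    ext x
    rw [iteratedDeriv_succ, ih, sum_pathSum_succ_mul]
    exact (HasDerivAt.fun_sum fun h _ => (hb h x).const_mul _).deriv

open scoped ContDiff in
theorem contDiff_of_hasDerivAt_pathStep
    (hb : ∀ h x, HasDerivAt (b h) (pathStep d u (fun k => b k x) h) x) : ContDiff ℝ ∞ (b 0) := by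
  refine contDiff_of_differentiable_iteratedDeriv fun N _ x => ?_
  rw [iteratedDeriv_eq_sum_pathSum hb]
  exact (HasDerivAt.fun_sum fun h _ => (hb h x).const_mul _).differentiableAt

theorem abs_iteratedDeriv_le_of_hasDerivAt_pathStep
    (hb : ∀ h x, HasDerivAt (b h) (pathStep d u (fun k => b k x) h) x)
    (hu : ∀ h : ℕ, |u h| ≤ h + 1) (hd : ∀ h : ℕ, |d h| ≤ h + 1) (hb_le : ∀ h x, |b h x| ≤ 1)
    (N : ℕ) (x : ℝ) : |iteratedDeriv N (b 0) x| ≤ 2 ^ N * N.factorial := by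
  rw [iteratedDeriv_eq_sum_pathSum hb]
  refine (Finset.abs_sum_le_sum_abs _ _).trans ((Finset.sum_le_sum fun h _ => ?_).trans
    (sum_pathSum_succ_le N))
  rw [abs_mul]
  exact (mul_le_of_le_one_right (abs_nonneg _) (hb_le h x)).trans (abs_pathSum_le hu hd N h)

end PathSumDeriv

/-! ### The Jacobi elliptic functions -/

section Jacobi

variable {α : ℝ}

theorem one_sub_mul_sin_sq_pos (hα : |α| < 1) (t : ℝ) : 0 < 1 - α ^ 2 * Real.sin t ^ 2 := by
  have hα_sq : α ^ 2 < 1 := (sq_lt_one_iff_abs_lt_one α).2 hα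
  nlinarith [Real.sin_sq_le_one t, sq_nonneg (Real.sin t), sq_nonneg α]

theorem hasDerivAt_ellipticF (hα : |α| < 1) (φ : ℝ) :
    HasDerivAt (ellipticF α) (1 / √(1 - α ^ 2 * Real.sin φ ^ 2)) φ := by
  have hcont : Continuous fun t => 1 / √(1 - α ^ 2 * Real.sin t ^ 2) :=
    continuous_const.div (by fun_prop)
      fun t => (Real.sqrt_pos.2 (one_sub_mul_sin_sq_pos hα t)).ne'
  exact intervalIntegral.integral_hasDerivAt_right (hcont.intervalIntegrable _ _)
    (hcont.stronglyMeasurableAtFilter _ _) hcont.continuousAt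

theorem ellipticF_zero : ellipticF α 0 = 0 := by simp [ellipticF]

theorem strictMono_ellipticF (hα : |α| < 1) : StrictMono (ellipticF α) :=
  strictMono_of_deriv_pos fun φ => by
    rw [(hasDerivAt_ellipticF hα φ).deriv]
    exact one_div_pos.2 (Real.sqrt_pos.2 (one_sub_mul_sin_sq_pos hα φ))

theorem surjective_ellipticF (hα : |α| < 1) : Function.Surjective (ellipticF α) := by
  have hderiv (φ : ℝ) : HasDerivAt (fun φ => ellipticF α φ - φ)
      (1 / √(1 - α ^ 2 * Real.sin φ ^ 2) - 1) φ :=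
    (hasDerivAt_ellipticF hα φ).sub (hasDerivAt_id φ)
  have hmono : Monotone fun φ => ellipticF α φ - φ := by
    refine monotone_of_deriv_nonneg (fun φ => (hderiv φ).differentiableAt) fun φ => ?_
    rw [(hderiv φ).deriv, sub_nonneg, le_div_iff₀ (Real.sqrt_pos.2 (one_sub_mul_sin_sq_pos hα φ)),
      one_mul]
    refine Real.sqrt_le_one.2 ?_
    nlinarith [mul_nonneg (sq_nonneg α) (sq_nonneg (Real.sin φ))]
  refine Continuous.surjective
    (continuous_iff_continuousAt.2 fun φ => (hasDerivAt_ellipticF hα φ).continuousAt) ?_ ?_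
  · refine Filter.tendsto_atTop_mono' _ ?_ Filter.tendsto_id
    filter_upwards [Filter.eventually_ge_atTop 0] with φ hφ
    simpa [ellipticF_zero] using hmono hφ
  · refine Filter.tendsto_atBot_mono' _ ?_ Filter.tendsto_id
    filter_upwards [Filter.eventually_le_atBot 0] with φ hφ
    simpa [ellipticF_zero] using hmono hφ

theorem ellipticF_jacobiAm (hα : |α| < 1) (u : ℝ) : ellipticF α (jacobiAm α u) = u :=
  Function.rightInverse_invFun (surjective_ellipticF hα) u

theorem jacobiAm_ellipticF (hα : |α| < 1) (φ : ℝ) : jacobiAm α (ellipticF α φ) = φ :=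
  Function.leftInverse_invFun (strictMono_ellipticF hα).injective φ

theorem jacobiAm_zero (hα : |α| < 1) : jacobiAm α 0 = 0 := by
  simpa only [ellipticF_zero] using jacobiAm_ellipticF hα 0

theorem continuous_jacobiAm (hα : |α| < 1) : Continuous (jacobiAm α) := by
  refine Monotone.continuous_of_surjective (fun u v huv => ?_)
    fun φ => ⟨_, jacobiAm_ellipticF hα φ⟩
  rwa [← (strictMono_ellipticF hα).le_iff_le, ellipticF_jacobiAm hα, ellipticF_jacobiAm hα]

/-- The Jacobi elliptic function `sn(u, α) = sin am(u, α)`. -/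
noncomputable def jacobiSn (α u : ℝ) : ℝ := Real.sin (jacobiAm α u)

/-- The Jacobi elliptic function `dn(u, α) = √(1 - α² sn(u, α)²)`. -/
noncomputable def jacobiDn (α u : ℝ) : ℝ := √(1 - α ^ 2 * jacobiSn α u ^ 2)

theorem jacobiDn_pos (hα : |α| < 1) (u : ℝ) : 0 < jacobiDn α u :=
  Real.sqrt_pos.2 (one_sub_mul_sin_sq_pos hα _)

theorem jacobiDn_sq (hα : |α| < 1) (u : ℝ) : jacobiDn α u ^ 2 = 1 - α ^ 2 * jacobiSn α u ^ 2 :=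
  Real.sq_sqrt (one_sub_mul_sin_sq_pos hα _).le

theorem jacobiCn_sq (α u : ℝ) : jacobiCn α u ^ 2 = 1 - jacobiSn α u ^ 2 := by
  rw [jacobiCn, jacobiSn, Real.cos_sq']

theorem hasDerivAt_jacobiAm (hα : |α| < 1) (u : ℝ) :
    HasDerivAt (jacobiAm α) (jacobiDn α u) u := by
  have hinv := HasDerivAt.of_local_left_inverse (continuous_jacobiAm hα).continuousAt
    (hasDerivAt_ellipticF hα (jacobiAm α u)) (one_div_pos.2 (jacobiDn_pos hα u)).ne'
    (Filter.Eventually.of_forall (ellipticF_jacobiAm hα))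
  rwa [one_div, inv_inv] at hinv

theorem hasDerivAt_jacobiSn (hα : |α| < 1) (u : ℝ) :
    HasDerivAt (jacobiSn α) (jacobiCn α u * jacobiDn α u) u :=
  (hasDerivAt_jacobiAm hα u).sin

theorem hasDerivAt_jacobiCn (hα : |α| < 1) (u : ℝ) :
    HasDerivAt (jacobiCn α) (-jacobiSn α u * jacobiDn α u) u :=
  (hasDerivAt_jacobiAm hα u).cos

theorem hasDerivAt_jacobiDn (hα : |α| < 1) (u : ℝ) :
    HasDerivAt (jacobiDn α) (-α ^ 2 * jacobiSn α u * jacobiCn α u) u := by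
  have hsqrt := ((((hasDerivAt_jacobiSn hα u).pow 2).const_mul (α ^ 2)).const_sub 1).sqrt
    (one_sub_mul_sin_sq_pos hα _).ne'
  refine hsqrt.congr_deriv ?_
  have hne := (jacobiDn_pos hα u).ne'
  change _ / (2 * jacobiDn α u) = _
  push_cast
  field_simp

theorem hasDerivAt_jacobiSn_pow_mul_jacobiCn (hα : |α| < 1) (h : ℕ) (u : ℝ) :
    HasDerivAt (fun u => jacobiSn α u ^ h * jacobiCn α u)
      ((h * jacobiSn α u ^ (h - 1) - (h + 1) * jacobiSn α u ^ (h + 1)) * jacobiDn α u) u := by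
  refine (((hasDerivAt_jacobiSn hα u).pow h).mul (hasDerivAt_jacobiCn hα u)).congr_deriv ?_
  rcases h with _ | h
  · simp
  · simp only [Pi.pow_apply, Nat.add_sub_cancel, Nat.cast_add_one]
    linear_combination (h + 1) * jacobiSn α u ^ h * jacobiDn α u * jacobiCn_sq α u

theorem hasDerivAt_jacobiSn_pow_mul_jacobiDn (hα : |α| < 1) (h : ℕ) (u : ℝ) :
    HasDerivAt (fun u => jacobiSn α u ^ h * jacobiDn α u)
      ((h * jacobiSn α u ^ (h - 1) - (h + 1) * α ^ 2 * jacobiSn α u ^ (h + 1)) * jacobiCn α u)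
      u := by
  refine (((hasDerivAt_jacobiSn hα u).pow h).mul (hasDerivAt_jacobiDn hα u)).congr_deriv ?_
  rcases h with _ | h
  · simp
  · simp only [Pi.pow_apply, Nat.add_sub_cancel, Nat.cast_add_one]
    linear_combination (h + 1) * jacobiSn α u ^ h * jacobiCn α u * jacobiDn_sq hα u

/-- The functions `snʰ cn` for even `h` and `snʰ dn` for odd `h`. They form a chain on which the
derivative acts as a transfer operator of lattice paths. -/
noncomputable def snPow (α : ℝ) (h : ℕ) (u : ℝ) : ℝ :=
  jacobiSn α u ^ h * if Even h then jacobiCn α u else jacobiDn α u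

/-- The coefficient of `snPow (h + 1)` in the derivative of `snPow h`. -/
noncomputable def snPowUpWeight (α : ℝ) (h : ℕ) : ℝ :=
  -((h + 1 : ℕ) * (α ^ 2) ^ (if Odd h then 1 else 0))

theorem hasDerivAt_snPow (hα : |α| < 1) (h : ℕ) (u : ℝ) : HasDerivAt (snPow α h)
    (pathStep (fun h => (h + 1 : ℝ)) (snPowUpWeight α) (fun k => snPow α k u) h) u := by
  rcases Nat.even_or_odd h with heven | hodd
  · have hfun : snPow α h = fun u => jacobiSn α u ^ h * jacobiCn α u := by
      ext u
      simp [snPow, heven]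
    rw [hfun]
    refine (hasDerivAt_jacobiSn_pow_mul_jacobiCn hα h u).congr_deriv ?_
    rcases h with _ | h
    · simp [pathStep, snPow, snPowUpWeight]
    · have hodd : Odd h := Nat.not_even_iff_odd.1 (Nat.even_add_one.1 heven)
      simp only [pathStep, snPow, snPowUpWeight, Nat.even_add_one, Nat.odd_add_one,
        Nat.not_even_iff_odd.2 hodd, hodd, not_true, not_false_iff, if_false,
        Nat.add_sub_cancel]
      push_cast
      ring
  · have hfun : snPow α h = fun u => jacobiSn α u ^ h * jacobiDn α u := by
      ext u
      simp [snPow, Nat.not_even_iff_odd.2 hodd]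
    rw [hfun]
    refine (hasDerivAt_jacobiSn_pow_mul_jacobiDn hα h u).congr_deriv ?_
    rcases h with _ | h
    · simp at hodd
    · have heven : Even h := Nat.not_odd_iff_even.1 (Nat.odd_add_one.1 hodd)
      simp only [pathStep, snPow, snPowUpWeight, Nat.even_add_one, Nat.odd_add_one,
        Nat.not_odd_iff_even.2 heven, heven, not_true, not_false_iff, if_true,
        Nat.add_sub_cancel]
      push_cast
      ring

theorem abs_snPow_le (α : ℝ) (h : ℕ) (u : ℝ) : |snPow α h u| ≤ 1 := by
  have hcn : |jacobiCn α u| ≤ 1 := Real.abs_cos_le_one _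
  have hdn : |jacobiDn α u| ≤ 1 := by
    rw [jacobiDn, abs_of_nonneg (Real.sqrt_nonneg _), Real.sqrt_le_one]
    nlinarith [mul_nonneg (sq_nonneg α) (sq_nonneg (jacobiSn α u))]
  rw [snPow, abs_mul, abs_pow]
  refine mul_le_one₀ (pow_le_one₀ (abs_nonneg _) (Real.abs_sin_le_one _)) (abs_nonneg _) ?_
  split_ifs <;> assumption

theorem snPow_apply_zero (hα : |α| < 1) (h : ℕ) : snPow α h 0 = if h = 0 then 1 else 0 := by
  rcases h with _ | h <;> simp [snPow, jacobiSn, jacobiCn, jacobiAm_zero hα]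

theorem snPow_zero (α : ℝ) : snPow α 0 = jacobiCn α := by
  ext u
  simp [snPow]

theorem iteratedDeriv_jacobiCn_zero (hα : |α| < 1) (N : ℕ) : iteratedDeriv N (jacobiCn α) 0 =
    pathSum (snPowUpWeight α) (fun h => (h + 1 : ℝ)) N 0 := by
  rw [← snPow_zero, iteratedDeriv_eq_sum_pathSum (hasDerivAt_snPow hα)]
  simp [snPow_apply_zero hα]

theorem hasSum_taylor_jacobiCn (hα : |α| < 1) {u : ℝ} (hu : |u| < 1 / 2) :
    HasSum (fun n => iteratedDeriv n (jacobiCn α) 0 * u ^ n / n.factorial) (jacobiCn α u) := by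
  have hchain := hasDerivAt_snPow hα
  have hα_sq : α ^ 2 ≤ 1 := ((sq_lt_one_iff_abs_lt_one α).2 hα).le
  have hup (h : ℕ) : |snPowUpWeight α h| ≤ h + 1 := by
    rw [snPowUpWeight, abs_neg, abs_of_nonneg (by positivity), Nat.cast_add_one]
    exact mul_le_of_le_one_right (by positivity) (pow_le_one₀ (sq_nonneg α) hα_sq)
  have hdown (h : ℕ) : |(h + 1 : ℝ)| ≤ h + 1 := (abs_of_pos (Nat.cast_add_one_pos h)).le
  have hbound := abs_iteratedDeriv_le_of_hasDerivAt_pathStep hchain hup hdown (abs_snPow_le α)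
  rw [← snPow_zero]
  simpa using hasSum_taylor_of_abs_iteratedDeriv_le (contDiff_of_hasDerivAt_pathStep hchain)
    (x₀ := 0) (C := 1) zero_le_two (by rw [sub_zero]; linarith) fun n t _ => by
      simpa using hbound n t

end Jacobi

theorem pathSum_snPowUpWeight (α : ℝ) (n : ℕ) :
    pathSum (snPowUpWeight α) (fun h => (h + 1 : ℝ)) (2 * n) 0 =
      (-1) ^ n * (cnPoly n).eval (α ^ 2) := by
  have hup : snPowUpWeight α = (-1 : ℝ) • (Polynomial.evalRingHom (α ^ 2) ∘ cnUpWeight) := by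
    ext h
    by_cases hodd : Odd h <;> simp [snPowUpWeight, cnUpWeight, hodd]
  have hdown : (fun h : ℕ => (h + 1 : ℝ)) =
      Polynomial.evalRingHom (α ^ 2) ∘ fun h => ((h + 1 : ℕ) : ℝ[X]) := by
    ext h
    simp
  rw [hup, hdown, pathSum_smul_up, ← map_pathSum, Nat.add_zero, Nat.mul_div_cancel_left n two_pos]
  rfl

theorem isCnTaylorSequence_cnPoly : IsCnTaylorSequence cnPoly := by
  intro α hα
  filter_upwards [Metric.ball_mem_nhds (0 : ℝ) one_half_pos] with u hu
  have hsum := hasSum_taylor_jacobiCn hα (by simpa using hu)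
  rw [← (mul_right_injective₀ (two_ne_zero' ℕ)).hasSum_iff fun m hm => ?_] at hsum
  · simpa only [Function.comp_def, iteratedDeriv_jacobiCn_zero hα, pathSum_snPowUpWeight] using hsum
  · have hodd : Odd m := Nat.not_even_iff_odd.1 fun heven =>
      hm (heven.exists_two_nsmul.imp fun _ h => h.symm)
    rw [iteratedDeriv_jacobiCn_zero hα, pathSum_eq_zero_of_odd _ _ (by simpa using hodd),
      zero_mul, zero_div]

theorem IsCnTaylorSequence.eq {c c' : ℕ → ℝ[X]} (hc : IsCnTaylorSequence c)
    (hc' : IsCnTaylorSequence c') : c = c' := by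
  have hform {c : ℕ → ℝ[X]} (hc : IsCnTaylorSequence c) {α : ℝ} (hα : |α| < 1) :
      ∀ᶠ u in nhds (0 : ℝ), HasSum (fun n => ((-1) ^ n * (c n).eval (α ^ 2) /
        (2 * n).factorial) * u ^ (2 * n)) (jacobiCn α u) := by
    simpa only [div_mul_eq_mul_div] using hc α hα
  ext1 n
  refine Polynomial.eq_of_infinite_eval_eq _ _
    ((Set.Ico_infinite (zero_lt_one' ℝ)).mono fun x hx => ?_)
  have hα : |√x| < 1 := by
    rw [abs_of_nonneg (Real.sqrt_nonneg x), Real.sqrt_lt' one_pos, one_pow]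
    exact hx.2
  have hcoeff := congrFun (eq_of_hasSum_evenPowerSeries (hform hc hα) (hform hc' hα)) n
  have hfactorial : ((2 * n).factorial : ℝ) ≠ 0 := by positivity
  rwa [div_left_inj' hfactorial, mul_right_inj' (by simp), Real.sq_sqrt hx.1] at hcoeff

theorem proposition4p6 :
    (∃! c : ℕ → ℝ[X], IsCnTaylorSequence c) ∧
    ∀ c : ℕ → ℝ[X], IsCnTaylorSequence c →
      (∀ n k : ℕ, (c n).coeff k =
        (Nat.card {σ : Equiv.Perm (Fin (2 * n)) //
          IsAlternatingPerm σ ∧ evenMinimaCount σ = k} : ℝ)) ∧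
      IsQLogConvex 3 c := by
  refine ⟨⟨_, isCnTaylorSequence_cnPoly, fun c hc => hc.eq isCnTaylorSequence_cnPoly⟩,
    fun c hc => ?_⟩
  rw [hc.eq isCnTaylorSequence_cnPoly]
  exact ⟨coeff_cnPoly, isQLogConvex_cnPoly⟩
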